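/- Let $X\subset\mathbb{R}^d$, let $Y\subset\mathbb{R}$ be non-empty and closed, let $p\ge 1$ and let $p'\in[1,\infty]$ be given by $1/p+1/p'=1$. Let $a:Y\to[0,\infty)$ be measurable and let $L:Y\times\mathbb{R}\to[0,\infty)$ be a measurable loss function that is convex in its second argument and of type $(a,p)$, i.e. there is $c>0$ with $L(y,t)\le c\,(a(y)+|t|^p+1)$ for all $y\in Y$, $t\in\mathbb{R}$. Let $H$ be the (real) reproducing kernel Hilbert space of a bounded, continuous kernel $k:X\times X\to\mathbb{R}$, with canonical feature map $\Phi(x)=k(\cdot,x)$, and let $\lambda>0$. For a probability measure $\mathrm{Q}$ on $X\times Y$ write $|\mathrm{Q}|_a:=\int a(y)\,d\mathrm{Q}(x,y)$, write $|\mathrm{Q}|_p:=\int |y|^p\,d\mathrm{Q}(x,y)$, and let $f_{\mathrm{Q},\lambda}\in H$ be the unique minimizer over $f\in H$ of $\mathbb{E}_{\mathrm{Q}}L(Y,f(X))+\lambda\|f\|_H^2$ (which exists if $|\mathrm{Q}|_a<\infty$). Let $\mathrm{P}$ be a probability measure on $X\times Y$ with $|\mathrm{P}|_a<\infty$. Then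 there exists a measurable function $h:X\times Y\to\mathbb{R}$ with $h\in L_{p'}(\mathrm{P})$ such that $h(x,y)\in\partial_2L(y,f_{\mathrm{P},\lambda}(x))$ for all $(x,y)\in X\times Y$, where $\partial_2L(y,t):=\{s\in\mathbb{R}: s(t'-t)\le L(y,t')-L(y,t)\text{ for all }t'\in\mathbb{R}\}$, and, with $h\Phi:(x,y)\mapsto h(x,y)\Phi(x)$ Bochner integrable with respect to $\mathrm{P}$, $$f_{\mathrm{P},\lambda}=-(2\lambda)^{-1}\,\mathbb{E}_{\mathrm{P}}h\Phi .$$ Moreover, for all probability measures $\mathrm{Q}$ on $X\times Y$ with $|\mathrm{Q}|_a<\infty$, we have $h\in L_1(\mathrm{Q})$, $h\Phi$ is Bochner integrable with respect to $\mathrm{Q}$, and $$\|f_{\mathrm{P},\lambda}-f_{\mathrm{Q},\lambda}\|_H\le\lambda^{-1}\,\|\mathbb{E}_{\mathrm{P}}h\Phi-\mathbb{E}_{\mathrm{Q}}h\Phi\|_H ,$$ and if, in addition, $L$ is an invariant loss of upper order $p$ (i.e. $L(y,t)=l(y-t)$ for a function $l:\mathbb{R}\to[0,\infty)$ with $l(0)=0$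 and $l(r)\le c'(|r|^p+1)$ for some $c'>0$ and all $r\in\mathbb{R}$) and $|\mathrm{P}|_p<\infty$, then $h\in L_{p'}(\mathrm{Q})$. -/

import Mathlib

open MeasureTheory

open scoped ENNReal

namespace KBR

noncomputable section

/-- `L : Y × ℝ → [0, ∞)` is a (jointly measurable) loss function. -/
structure IsLoss {Y : Set ℝ} (L : Y → ℝ → ℝ) : Prop where
  measurable : Measurable (Function.uncurry L)
  nonneg : ∀ y t, 0 ≤ L y t

/-- The loss is convex in its second argument. -/
def IsConvexLoss {Y : Set ℝ} (L : Y → ℝ → ℝ) : Prop :=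
  ∀ y, ConvexOn ℝ Set.univ (L y)

/-- `L` is of type `(a, p)`. -/
def IsOfType {Y : Set ℝ} (L : Y → ℝ → ℝ) (a : Y → ℝ) (p : ℝ) : Prop :=
  ∃ c : ℝ, 0 < c ∧ ∀ y t, L y t ≤ c * (a y + |t| ^ p + 1)

/-- `L` is invariant with associated function `l : ℝ → [0, ∞)`. -/
structure IsInvariantWith {Y : Set ℝ} (L : Y → ℝ → ℝ) (l : ℝ → ℝ) : Prop where
  nonneg : ∀ r, 0 ≤ l r
  map_zero : l 0 = 0
  eq_sub : ∀ (y : Y) (t : ℝ), L y t = l ((y : ℝ) - t)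

/-- `L` is an invariant loss of upper order `p`. -/
def IsInvariantOfUpperOrder {Y : Set ℝ} (L : Y → ℝ → ℝ) (p : ℝ) : Prop :=
  ∃ l : ℝ → ℝ, IsInvariantWith L l ∧ ∃ c : ℝ, 0 < c ∧ ∀ r, l r ≤ c * (|r| ^ p + 1)

/-- The subdifferential of a finite function `F` on a Hilbert space at `w`. -/
def subdifferential {E : Type*} [NormedAddCommGroup E] [InnerProductSpace ℝ E]
    (F : E → ℝ) (w : E) : Set E :=
  {s | ∀ v, inner ℝ s (v - w) ≤ F v - F w}

/-- `|μ|_a = ∫ a(y) dμ(x, y)` for a nonnegative measure `μ` on `X × Y`. -/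
def absMoment {X : Type*} [MeasurableSpace X] {Y : Set ℝ} (a : Y → ℝ)
    (μ : Measure (X × Y)) : ℝ≥0∞ :=
  ∫⁻ z, ENNReal.ofReal (a z.2) ∂μ

/-- The `L`-risk `E_P L(Y, f(X))`, with values in `[0, ∞]`. -/
def risk {X : Type*} [MeasurableSpace X] {Y : Set ℝ} (L : Y → ℝ → ℝ)
    (P : Measure (X × Y)) (f : X → ℝ) : ℝ≥0∞ :=
  ∫⁻ z, ENNReal.ofReal (L z.2 (f z.1)) ∂P

section RKHS

variable {X : Type*} (H : Type*) [NormedAddCommGroup H] [InnerProductSpace ℝ H]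
  [RKHS ℝ H X ℝ]

/-- The canonical feature map: `featureMap H x` is the representer of evaluation at `x`. -/
def featureMap [CompleteSpace H] (x : X) : H := RKHS.kerFun H x 1

/-- `H` is the RKHS of the kernel `k`, i.e. the canonical feature map is `x ↦ k(·, x)`. -/
def IsRKHSOf [CompleteSpace H] (k : X → X → ℝ) : Prop :=
  ∀ x x' : X, featureMap H x x' = k x' x

/-- The regularized risk `E_P L(Y, f(X)) + lam * ‖f‖²`, with values in `[0, ∞]`. -/
def regRisk [MeasurableSpace X] {Y : Set ℝ} (L : Y → ℝ → ℝ)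
    (P : Measure (X × Y)) (lam : ℝ) (f : H) : ℝ≥0∞ :=
  risk L P f + ENNReal.ofReal (lam * ‖f‖ ^ 2)

open Classical in
/-- `f_{P,lam}`: the unique minimizer of the regularized risk over `H`
(and `0` if there is no unique minimizer). -/
def kbrSolution [MeasurableSpace X] {Y : Set ℝ} (L : Y → ℝ → ℝ)
    (P : Measure (X × Y)) (lam : ℝ) : H :=
  if hex : ∃! f : H, ∀ g : H, regRisk H L P lam f ≤ regRisk H L P lam g then hex.choose else 0

end RKHS

/-- The kernel is bounded: `sup_x √(k(x, x)) < ∞`. -/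
def IsBoundedKernel {X : Type*} (k : X → X → ℝ) : Prop :=
  BddAbove (Set.range fun x => √(k x x))

end

end KBR

/-! Evaluation at `x` is the inner product with `Φ x`, so the problem concerns losses `l ω ⟪f, Φ ω⟫`
integrated over a finite measure. The directional derivative of the risk at the minimizer `f` in
direction `g` is the integral of the one-sided slopes of the loss against `⟪g, Φ⟫`. It is also the
largest value of `⟪g, ∫ h • Φ⟫` over measurable `h` lying between the left and right slopes.

Minimality says that this support function dominates `⟪g, -2λf⟫` for every `g`. If the set of
vectors `∫ h • Φ` is closed, Hahn-Banach puts `-2λf` in it, and this is the representation.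
Closedness holds because the admissible weights form a closed convex bounded set in `L²`; nested
closed convex bounded sets in a Hilbert space meet, which plays the role of weak compactness
(`exists_weight_integral_smul_eq`).

The selected `h` consists of subgradients at every point, not just almost everywhere under `P`.
Hence `E_Q hΦ` is a subgradient of the `Q`-risk at `f` for every admissible `Q`. The quadratic term
kept by the regularizer then bounds the distance from `f` to the `Q`-minimizer
(`norm_sub_le_of_minimizer`). All integrability of `h` comes from the pointwise estimate
`subgradient_le_of_growth`. -/

namespace KBR

open Filter Topology Set

/-- The right derivative of a function on the real line. -/
noncomputable def rightSlope (φ : ℝ → ℝ) (t : ℝ) : ℝ := derivWithin φ (Ioi t) t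

/-- The left derivative of a function on the real line. -/
noncomputable def leftSlope (φ : ℝ → ℝ) (t : ℝ) : ℝ := derivWithin φ (Iio t) t

/-! ### One-sided slopes and subgradients of convex functions on the line. -/

section Line

variable {φ : ℝ → ℝ} {s t : ℝ}

lemma leftSlope_le_rightSlope (hφ : ConvexOn ℝ univ φ) (t : ℝ) :
    leftSlope φ t ≤ rightSlope φ t :=
  hφ.leftDeriv_le_rightDeriv_of_mem_interior (by simp)

lemma mul_sub_le_of_mem_Icc_slopes (hφ : ConvexOn ℝ univ φ)
    (hs : s ∈ Icc (leftSlope φ t) (rightSlope φ t)) (v : ℝ) :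
    s * (v - t) ≤ φ v - φ t := by
  rcases lt_trichotomy v t with hv | rfl | hv
  · have h := hφ.slope_le_leftDeriv_of_mem_interior (mem_univ v) (x := v) (y := t) (by simp) hv
    have h1 : slope φ v t ≤ s := h.trans hs.1
    rw [slope_def_field, div_le_iff₀ (by linarith)] at h1
    linarith
  · simp
  · have h := hφ.rightDeriv_le_slope_of_mem_interior (x := t) (y := v) (by simp) (mem_univ v) hv
    have h1 : s ≤ slope φ t v := hs.2.trans h
    rw [slope_def_field, le_div_iff₀ (by linarith)] at h1
    linarith

/-- Test the subgradient inequality at `t ± δ`. With `δ = 1 + A ^ p⁻¹` both `A` and `1` are at most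
`δ ^ p`, so `φ` is of order `δ ^ p` there, and dividing by `δ` leaves `δ ^ (p - 1)`. This is the
power that belongs to `L_{p'}` when `A` is integrable. -/
lemma subgradient_le_of_growth {A B c p : ℝ} (hp : 1 ≤ p) (hA : 0 ≤ A) (hc : 0 ≤ c)
    (hφ0 : 0 ≤ φ t) (hφ : ∀ v, φ v ≤ c * (A + |v| ^ p + 1))
    (ht : |t| ≤ B) (hs : ∀ v, s * (v - t) ≤ φ v - φ t) :
    |s| ≤ c * ((B + 1) ^ p + 2) * (1 + A ^ p⁻¹) ^ (p - 1) := by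
  have hB : 0 ≤ B := (abs_nonneg t).trans ht
  set δ : ℝ := 1 + A ^ p⁻¹ with hδ
  have hA' : 0 ≤ A ^ p⁻¹ := Real.rpow_nonneg hA _
  have hδ1 : 1 ≤ δ := by linarith
  have hδ0 : 0 < δ := by linarith
  have hp0 : 0 ≤ p := by linarith
  have hAδ : A ≤ δ ^ p := by
    calc A = (A ^ p⁻¹) ^ p := by rw [← Real.rpow_mul hA, inv_mul_cancel₀ (by linarith), Real.rpow_one]
      _ ≤ δ ^ p := Real.rpow_le_rpow hA' (by linarith) hp0
  have h1δ : 1 ≤ δ ^ p := Real.one_le_rpow hδ1 hp0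
  have hpow : δ ^ p = δ ^ (p - 1) * δ := by
    nth_rewrite 3 [← Real.rpow_one δ]
    rw [← Real.rpow_add hδ0]; ring_nf
  have key : ∀ v, |v - t| ≤ δ → φ v ≤ c * ((B + 1) ^ p + 2) * δ ^ p := by
    intro v hv
    have hv' : |v| ≤ (B + 1) * δ := by
      have : |v| ≤ |v - t| + |t| := by simpa using abs_add_le (v - t) t
      nlinarith
    have h2 : |v| ^ p ≤ (B + 1) ^ p * δ ^ p := by
      rw [← Real.mul_rpow (by linarith) hδ0.le]
      exact Real.rpow_le_rpow (abs_nonneg _) hv' hp0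
    calc φ v ≤ c * (A + |v| ^ p + 1) := hφ v
      _ ≤ c * (δ ^ p + (B + 1) ^ p * δ ^ p + δ ^ p) := by gcongr
      _ = _ := by ring
  have hmul : |s| * δ ≤ c * ((B + 1) ^ p + 2) * δ ^ p := by
    rcases le_total 0 s with h0 | h0
    · have h1 := hs (t + δ)
      have h2 := key (t + δ) (by simp [abs_of_pos hδ0])
      rw [abs_of_nonneg h0]
      have : s * (t + δ - t) = s * δ := by ring
      linarith
    · have h1 := hs (t - δ)
      have h2 := key (t - δ) (by simp [abs_of_pos hδ0])
      rw [abs_of_nonpos h0]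
      have : s * (t - δ - t) = -s * δ := by ring
      linarith
  rw [hpow, ← mul_assoc] at hmul
  exact le_of_mul_le_mul_right hmul hδ0

lemma tendsto_slope_rightSlope (hφ : ConvexOn ℝ univ φ) {ι : Type*} {l : Filter ι} {ε : ι → ℝ}
    (hε : Tendsto ε l (𝓝[>] 0)) :
    Tendsto (fun i => (φ (t + ε i) - φ t) / ε i) l (𝓝 (rightSlope φ t)) := by
  have h := hφ.hasDerivWithinAt_rightDeriv_of_mem_interior (x := t) (by simp)
  rw [hasDerivWithinAt_iff_tendsto_slope' (by simp)] at h
  have h2 : Tendsto (fun i => t + ε i) l (𝓝[>] t) := by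
    rw [tendsto_nhdsWithin_iff] at hε ⊢
    refine ⟨by simpa using hε.1.const_add t, hε.2.mono fun i hi => ?_⟩
    simpa using hi
  refine (h.comp h2).congr fun i => ?_
  simp [slope_def_field]

lemma tendsto_slope_leftSlope (hφ : ConvexOn ℝ univ φ) {ι : Type*} {l : Filter ι} {ε : ι → ℝ}
    (hε : Tendsto ε l (𝓝[>] 0)) :
    Tendsto (fun i => (φ t - φ (t - ε i)) / ε i) l (𝓝 (leftSlope φ t)) := by
  have h := hφ.hasDerivWithinAt_leftDeriv_of_mem_interior (x := t) (by simp)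
  rw [hasDerivWithinAt_iff_tendsto_slope' (by simp)] at h
  have h2 : Tendsto (fun i => t - ε i) l (𝓝[<] t) := by
    rw [tendsto_nhdsWithin_iff] at hε ⊢
    refine ⟨by simpa using hε.1.const_sub t, hε.2.mono fun i hi => ?_⟩
    simpa using hi
  refine (h.comp h2).congr fun i => ?_
  simp only [Function.comp_apply, slope_def_field]
  rw [← neg_div_neg_eq]
  congr 1 <;> ring

lemma tendsto_mul_pos_nhdsGT_zero {ι : Type*} {l : Filter ι} {ε : ι → ℝ} {d : ℝ}
    (hε : Tendsto ε l (𝓝[>] 0)) (hd : 0 < d) : Tendsto (fun i => ε i * d) l (𝓝[>] 0) := by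
  rw [tendsto_nhdsWithin_iff] at hε ⊢
  refine ⟨by simpa using hε.1.mul_const d, hε.2.mono fun i hi => ?_⟩
  exact mul_pos hi hd

/-- The directional derivative of a convex function on the line. -/
lemma tendsto_directional_slope (hφ : ConvexOn ℝ univ φ) {ι : Type*} {l : Filter ι} {ε : ι → ℝ}
    (hε : Tendsto ε l (𝓝[>] 0)) (d : ℝ) :
    Tendsto (fun i => (φ (t + ε i * d) - φ t) / ε i) l
      (𝓝 (leftSlope φ t * d + (rightSlope φ t - leftSlope φ t) * max d 0)) := by
  rcases lt_trichotomy d 0 with hd | rfl | hd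
  · have h := (tendsto_slope_leftSlope hφ (t := t)
      (tendsto_mul_pos_nhdsGT_zero hε (neg_pos.2 hd))).mul_const d
    rw [max_eq_right hd.le, mul_zero, add_zero]
    refine h.congr fun i => ?_
    have : t - ε i * -d = t + ε i * d := by ring
    rw [this, mul_neg, div_neg, ← neg_div, neg_sub, ← div_div, div_mul_cancel₀ _ hd.ne]
  · simp [tendsto_const_nhds]
  · have h := (tendsto_slope_rightSlope hφ (t := t)
      (tendsto_mul_pos_nhdsGT_zero hε hd)).mul_const d
    rw [max_eq_left hd.le, sub_mul, add_sub_cancel]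
    refine h.congr fun i => ?_
    field_simp

lemma slope_le_sub_of_le_one (hφ : ConvexOn ℝ univ φ) {ε : ℝ} (hε0 : 0 < ε) (hε1 : ε ≤ 1)
    (d : ℝ) : (φ (t + ε * d) - φ t) / ε ≤ φ (t + d) - φ t := by
  rw [div_le_iff₀ hε0]
  have h := hφ.2 (mem_univ t) (mem_univ (t + d)) (sub_nonneg.2 hε1) hε0.le (by ring)
  simp only [smul_eq_mul] at h
  have : (1 - ε) * t + ε * (t + d) = t + ε * d := by ring
  rw [this] at h
  linarith

end Line

/-! ### Measurability of the one-sided slopes, as limits of difference quotients. -/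

section Measurability

variable {Ω : Type*} [MeasurableSpace Ω] {l : Ω → ℝ → ℝ} {u : Ω → ℝ}

lemma tendsto_one_div_nat_nhdsGT_zero :
    Tendsto (fun n : ℕ => 1 / ((n : ℝ) + 1)) atTop (𝓝[>] 0) := by
  rw [tendsto_nhdsWithin_iff]
  exact ⟨tendsto_one_div_add_atTop_nhds_zero_nat, .of_forall fun n => by
    simp only [mem_Ioi]; positivity⟩

lemma measurable_rightSlope (hl : Measurable (Function.uncurry l))
    (hconv : ∀ ω, ConvexOn ℝ univ (l ω)) (hu : Measurable u) :
    Measurable fun ω => rightSlope (l ω) (u ω) := by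
  refine measurable_of_tendsto_metrizable
    (f := fun (n : ℕ) ω => (l ω (u ω + 1 / ((n : ℝ) + 1)) - l ω (u ω)) / (1 / ((n : ℝ) + 1)))
    (fun n => ?_)
    (tendsto_pi_nhds.2 fun ω => tendsto_slope_rightSlope (hconv ω) tendsto_one_div_nat_nhdsGT_zero)
  exact ((hl.comp (measurable_id.prodMk (hu.add_const _))).sub
    (hl.comp (measurable_id.prodMk hu))).div_const _

lemma measurable_leftSlope (hl : Measurable (Function.uncurry l))
    (hconv : ∀ ω, ConvexOn ℝ univ (l ω)) (hu : Measurable u) :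
    Measurable fun ω => leftSlope (l ω) (u ω) := by
  refine measurable_of_tendsto_metrizable
    (f := fun (n : ℕ) ω => (l ω (u ω) - l ω (u ω - 1 / ((n : ℝ) + 1))) / (1 / ((n : ℝ) + 1)))
    (fun n => ?_)
    (tendsto_pi_nhds.2 fun ω => tendsto_slope_leftSlope (hconv ω) tendsto_one_div_nat_nhdsGT_zero)
  exact ((hl.comp (measurable_id.prodMk hu)).sub
    (hl.comp (measurable_id.prodMk (hu.sub_const _)))).div_const _

end Measurability

/-! ### The conjugate exponent. -/

section Integrability

variable {Ω : Type*} [MeasurableSpace Ω] {μ : Measure Ω} [IsFiniteMeasure μ]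

lemma memLp_one_add_rpow {A : Ω → ℝ} (hA : Integrable A μ) (hA0 : ∀ ω, 0 ≤ A ω) {p : ℝ}
    (hp : 1 ≤ p) {p' : ℝ≥0∞} (hp' : ENNReal.HolderConjugate (ENNReal.ofReal p) p') :
    MemLp (fun ω => (1 + A ω ^ p⁻¹) ^ (p - 1)) p' μ := by
  have hp0 : 0 < p := by linarith
  have h1 : MemLp (fun ω => A ω ^ p⁻¹) (ENNReal.ofReal p) μ := by
    have h := (memLp_one_iff_integrable.2 hA).norm_rpow_div (ENNReal.ofReal p⁻¹)
    rw [ENNReal.ofReal_inv_of_pos hp0, one_div, inv_inv, ENNReal.toReal_inv,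
      ENNReal.toReal_ofReal hp0.le] at h
    have e : (fun ω => A ω ^ p⁻¹) = fun ω => ‖A ω‖ ^ p⁻¹ :=
      funext fun ω => by rw [Real.norm_of_nonneg (hA0 ω)]
    rw [e]
    exact h
  have h2 : MemLp (fun ω => 1 + A ω ^ p⁻¹) (ENNReal.ofReal p) μ :=
    (memLp_const (1 : ℝ)).add h1
  have h3 := h2.norm_rpow_div (ENNReal.ofReal (p - 1))
  have hpp : ENNReal.ofReal p / ENNReal.ofReal (p - 1) = p' := by
    rw [(ENNReal.isConjExponent_iff_eq_conjExponent (by simpa using hp)).1 hp']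
    have e : ENNReal.ofReal p = ENNReal.ofReal (p - 1) + 1 := by
      rw [← ENNReal.ofReal_one, ← ENNReal.ofReal_add (by linarith) zero_le_one, sub_add_cancel]
    rw [e, ENNReal.add_sub_cancel_right ENNReal.one_ne_top, ENNReal.add_div, one_div]
    rcases eq_or_ne (ENNReal.ofReal (p - 1)) 0 with h0 | h0
    -- The case `p = 1`: in `ℝ≥0∞` the quotient `1 / 0` is `∞`, the correct conjugate exponent.
    · simp [h0]
    · rw [ENNReal.div_self h0 ENNReal.ofReal_ne_top]
  rw [hpp, ENNReal.toReal_ofReal (by linarith)] at h3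
  have e : (fun ω => (1 + A ω ^ p⁻¹) ^ (p - 1)) = fun ω => ‖1 + A ω ^ p⁻¹‖ ^ (p - 1) :=
    funext fun ω => by
      rw [Real.norm_of_nonneg (add_nonneg zero_le_one (Real.rpow_nonneg (hA0 ω) _))]
  rw [e]
  exact h3

end Integrability

/-! ### Closed convex sets and Tikhonov minimizers in Hilbert space. -/

section Hilbert

variable {E F : Type*} [NormedAddCommGroup E] [InnerProductSpace ℝ E] [CompleteSpace E]

/-- A decreasing sequence of nonempty closed convex bounded sets in a Hilbert space has a common
point. -/
theorem nonempty_iInter_of_antitone_closed_convex {C : ℕ → Set E} (hC : Antitone C)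
    (hne : ∀ n, (C n).Nonempty) (hcl : ∀ n, IsClosed (C n)) (hconv : ∀ n, Convex ℝ (C n))
    {M : ℝ} (hM : ∀ x ∈ C 0, ‖x‖ ≤ M) : (⋂ n, C n).Nonempty := by
  have hmin : ∀ n, ∃ x ∈ C n, ∀ y ∈ C n, ‖x‖ ≤ ‖y‖ := fun n => by
    obtain ⟨x, hx, h⟩ := exists_norm_eq_iInf_of_complete_convex (hne n) (hcl n).isComplete
      (hconv n) 0
    refine ⟨x, hx, fun y hy => ?_⟩
    have : ⨅ w : C n, ‖(0 : E) - w‖ ≤ ‖(0 : E) - (⟨y, hy⟩ : C n)‖ :=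
      ciInf_le ⟨0, by rintro _ ⟨w, rfl⟩; exact norm_nonneg _⟩ _
    rw [← h] at this
    simpa using this
  choose x hxC hxmin using hmin
  have hmono : Monotone fun n => ‖x n‖ ^ 2 := fun m n hmn =>
    pow_le_pow_left₀ (norm_nonneg _) (hxmin m _ (hC hmn (hxC n))) 2
  have hbdd : BddAbove (range fun n => ‖x n‖ ^ 2) := ⟨M ^ 2, by
    rintro _ ⟨n, rfl⟩
    exact pow_le_pow_left₀ (norm_nonneg _) (hM _ (hC (Nat.zero_le n) (hxC n))) 2⟩
  -- The midpoint of `x n` and `x m` stays in `C m`, so its norm is at least `‖x m‖`; the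
  -- parallelogram law then makes the minimal-norm points Cauchy, since their norms increase and are
  -- bounded.
  have hdist : ∀ m n, m ≤ n → ‖x n - x m‖ ^ 2 ≤ 2 * (‖x n‖ ^ 2 - ‖x m‖ ^ 2) := fun m n hmn => by
    have hmid : (1 / 2 : ℝ) • x n + (1 / 2 : ℝ) • x m ∈ C m :=
      hconv m (hC hmn (hxC n)) (hxC m) (by norm_num) (by norm_num) (by norm_num)
    have h1 := hxmin m _ hmid
    rw [← smul_add, norm_smul, Real.norm_of_nonneg (by norm_num)] at h1
    have h2 : ‖x n + x m‖ ^ 2 + ‖x n - x m‖ ^ 2 = 2 * (‖x n‖ ^ 2 + ‖x m‖ ^ 2) := by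
      have := parallelogram_law_with_norm ℝ (x n) (x m)
      simp only [sq]; linarith
    nlinarith [norm_nonneg (x m), norm_nonneg (x n + x m)]
  have hcauchy : CauchySeq x := by
    have hc := (tendsto_atTop_ciSup hmono hbdd).cauchySeq
    rw [Metric.cauchySeq_iff'] at hc ⊢
    intro ε hε
    obtain ⟨N, hN⟩ := hc (ε ^ 2 / 2) (by positivity)
    refine ⟨N, fun n hn => ?_⟩
    have h1 := hN n hn
    rw [Real.dist_eq, abs_of_nonneg (sub_nonneg.2 (hmono hn))] at h1
    rw [dist_eq_norm]
    have h2 := hdist N n hn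
    exact lt_of_pow_lt_pow_left₀ 2 hε.le (by linarith)
  obtain ⟨y, hy⟩ := cauchySeq_tendsto_of_complete hcauchy
  refine ⟨y, mem_iInter.2 fun n => (hcl n).mem_of_tendsto hy ?_⟩
  filter_upwards [eventually_ge_atTop n] with k hk using hC hk (hxC k)

/-- The image of a closed convex bounded set of a Hilbert space under a continuous linear map is
closed. -/
theorem isClosed_image_of_closed_convex_bounded [NormedAddCommGroup F] [NormedSpace ℝ F]
    (T : E →L[ℝ] F) {C : Set E} (hcl : IsClosed C) (hconv : Convex ℝ C) {M : ℝ}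
    (hM : ∀ x ∈ C, ‖x‖ ≤ M) : IsClosed (T '' C) := by
  refine isClosed_of_closure_subset fun v hv => ?_
  -- A common point of these nested sets is a preimage in `C` of the closure point `v`.
  have hne : (⋂ n : ℕ, C ∩ T ⁻¹' Metric.closedBall v (1 / ((n : ℝ) + 1))).Nonempty := by
    refine nonempty_iInter_of_antitone_closed_convex (M := M) (fun m n hmn => ?_) (fun n => ?_)
      (fun n => hcl.inter (Metric.isClosed_closedBall.preimage T.continuous))
      (fun n => hconv.inter ((convex_closedBall v _).linear_preimage T.toLinearMap))
      fun x hx => hM x hx.1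
    · exact inter_subset_inter_right _ (preimage_mono
        (Metric.closedBall_subset_closedBall (one_div_le_one_div_of_le (by positivity)
          (by gcongr))))
    · obtain ⟨_, ⟨x, hx, rfl⟩, hxv⟩ := Metric.mem_closure_iff.1 hv (1 / ((n : ℝ) + 1))
        (by positivity)
      exact ⟨x, hx, by rw [mem_preimage, Metric.mem_closedBall, dist_comm]; exact hxv.le⟩
  obtain ⟨x, hx⟩ := hne
  rw [mem_iInter] at hx
  refine ⟨x, (hx 0).1, ?_⟩
  rw [← dist_le_zero]
  exact ge_of_tendsto' tendsto_one_div_add_atTop_nhds_zero_nat fun n => (hx n).2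

omit [CompleteSpace E] in
-- The expansion of `‖g‖ ^ 2` around `f` is exact, so nothing of the quadratic term is lost. This
-- strong convexity drives both uniqueness of minimizers and the stability bound.
lemma add_inner_add_norm_sq_le {R : E → ℝ} {f w : E}
    (hw : ∀ g, R f + inner ℝ w (g - f) ≤ R g) (lam : ℝ) (g : E) :
    R f + lam * ‖f‖ ^ 2 + inner ℝ (w + (2 * lam) • f) (g - f) + lam * ‖g - f‖ ^ 2 ≤
      R g + lam * ‖g‖ ^ 2 := by
  have h := hw g
  have e : ‖g‖ ^ 2 = ‖f‖ ^ 2 + 2 * inner ℝ f (g - f) + ‖g - f‖ ^ 2 := by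
    rw [← norm_add_sq_real, add_sub_cancel]
  rw [e, inner_add_left, inner_smul_left]
  simp only [conj_trivial]
  linarith

/-- A nonnegative function with a subgradient at each point has, after Tikhonov regularization,
a unique minimizer. -/
theorem existsUnique_minimizer_of_subgradients {R : E → ℝ} (hR : ∀ f, 0 ≤ R f)
    (hsub : ∀ f, ∃ w : E, ∀ g, R f + inner ℝ w (g - f) ≤ R g) {lam : ℝ} (hlam : 0 < lam) :
    ∃! f : E, ∀ g, R f + lam * ‖f‖ ^ 2 ≤ R g + lam * ‖g‖ ^ 2 := by
  choose w hw using hsub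
  set J : E → ℝ := fun f => R f + lam * ‖f‖ ^ 2 with hJ
  have hJ0 : ∀ f, 0 ≤ J f := fun f => add_nonneg (hR f) (by positivity)
  have hJsub : ∀ f g, J f + inner ℝ (w f + (2 * lam) • f) (g - f) + lam * ‖g - f‖ ^ 2 ≤ J g :=
    fun f g => add_inner_add_norm_sq_le (hw f) lam g
  -- `J` is the supremum of its affine minorants, so its sublevel sets are intersections of
  -- half-spaces, hence closed and convex.
  have hlevel : ∀ c, {g | J g ≤ c} =
      ⋂ f, {g | inner ℝ (w f + (2 * lam) • f) g ≤ c - J f + inner ℝ (w f + (2 * lam) • f) f} := by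
    intro c
    ext g
    simp only [mem_ofPred_eq, mem_iInter]
    refine ⟨fun h f => ?_, fun h => by linarith [h g]⟩
    have h1 := hJsub f g
    rw [inner_sub_right] at h1
    have : 0 ≤ lam * ‖g - f‖ ^ 2 := by positivity
    linarith
  have hcl : ∀ c, IsClosed {g | J g ≤ c} := fun c => by
    rw [hlevel]
    exact isClosed_iInter fun f => isClosed_le (by fun_prop) continuous_const
  have hconv : ∀ c, Convex ℝ {g | J g ≤ c} := fun c => by
    rw [hlevel]
    exact convex_iInter fun f => convex_halfSpace_le (innerₛₗ ℝ _).isLinear _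
  have hbdd : BddBelow (range J) := ⟨0, by rintro _ ⟨f, rfl⟩; exact hJ0 f⟩
  have hne : (⋂ n : ℕ, {g | J g ≤ (⨅ f, J f) + 1 / ((n : ℝ) + 1)}).Nonempty := by
    refine nonempty_iInter_of_antitone_closed_convex
      (M := √(((⨅ f, J f) + 1) / lam)) (fun m n hmn g hg => ?_) (fun n => ?_)
      (fun n => hcl _) (fun n => hconv _) fun g hg => ?_
    · have : 1 / ((n : ℝ) + 1) ≤ 1 / ((m : ℝ) + 1) :=
        one_div_le_one_div_of_le (by positivity) (by gcongr)
      simp only [mem_ofPred_eq] at hg ⊢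
      linarith
    · obtain ⟨g, hg⟩ := exists_lt_of_ciInf_lt
        (show (⨅ f, J f) < (⨅ f, J f) + 1 / ((n : ℝ) + 1) by
          have : 0 < 1 / ((n : ℝ) + 1) := by positivity
          linarith)
      exact ⟨g, hg.le⟩
    · refine Real.le_sqrt_of_sq_le ?_
      rw [le_div_iff₀ hlam]
      simp only [mem_ofPred_eq, Nat.cast_zero, zero_add, div_one, hJ] at hg
      linarith [hR g]
  obtain ⟨f, hf⟩ := hne
  have hfmin : ∀ g, J f ≤ J g := by
    have h0 : J f ≤ ⨅ f, J f := by
      have ht := tendsto_one_div_add_atTop_nhds_zero_nat (𝕜 := ℝ) |>.const_add (⨅ f, J f)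
      rw [add_zero] at ht
      exact ge_of_tendsto' ht fun n => mem_iInter.1 hf n
    exact fun g => h0.trans (ciInf_le hbdd g)
  refine ⟨f, hfmin, fun f' hf' => ?_⟩
  -- Adding the inequalities at the midpoint towards `f` and `f'` cancels the linear terms; only the
  -- quadratic ones remain, and they must vanish.
  set m : E := (1 / 2 : ℝ) • (f + f') with hm
  have h1 := hJsub m f
  have h2 := hJsub m f'
  have e : f' - m = -(f - m) := by rw [hm]; module
  rw [e, inner_neg_right, norm_neg] at h2
  have h3 := hfmin m
  have h4 : J f' ≤ J m := hf' m
  have h5 : ‖f - m‖ ^ 2 ≤ 0 := by nlinarith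
  have h6 : f - m = 0 := by
    rw [← norm_eq_zero]; exact pow_eq_zero_iff two_ne_zero |>.1 (le_antisymm h5 (by positivity))
  have h7 : f' - f = (-2 : ℝ) • (f - m) := by rw [hm]; module
  rw [h6, smul_zero, sub_eq_zero] at h7
  exact h7

end Hilbert

/-! ### Vectors of the form `∫ h • Φ` with `h` between given bounds. -/

section WeightedMean

variable {Ω : Type*} [MeasurableSpace Ω] {H : Type*} [NormedAddCommGroup H]
  [InnerProductSpace ℝ H] {Φ : Ω → H} {B : ℝ}

/-- Integration of square integrable weights against a bounded vector valued function. -/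
lemma exists_continuousLinearMap_integral_smul (μ : Measure Ω) [IsFiniteMeasure μ]
    (hΦ : StronglyMeasurable Φ) (hB : ∀ ω, ‖Φ ω‖ ≤ B) :
    ∃ T : Lp ℝ 2 μ →L[ℝ] H, ∀ θ, T θ = ∫ ω, θ ω • Φ ω ∂μ := by
  have hint : ∀ θ : Lp ℝ 2 μ, Integrable (fun ω => θ ω • Φ ω) μ := fun θ =>
    ((Lp.memLp θ).integrable (by norm_num)).smul_bdd B hΦ.aestronglyMeasurable
      (.of_forall hB)
  have hΩ : ∀ θ : Lp ℝ 2 μ, ∫ ω, ‖θ ω‖ ∂μ ≤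
      ‖θ‖ * (μ univ ^ (1 / (1 : ℝ≥0∞).toReal - 1 / (2 : ℝ≥0∞).toReal)).toReal := fun θ => by
    rw [integral_norm_eq_lintegral_enorm (Lp.aestronglyMeasurable θ), ← eLpNorm_one_eq_lintegral_enorm,
      Lp.norm_def, ← ENNReal.toReal_mul]
    refine ENNReal.toReal_mono (ENNReal.mul_ne_top (Lp.eLpNorm_ne_top θ) ?_)
      (eLpNorm_le_eLpNorm_mul_rpow_measure_univ (by norm_num) (Lp.aestronglyMeasurable θ))
    exact ENNReal.rpow_ne_top_of_nonneg (by norm_num) (measure_ne_top _ _)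
  refine ⟨LinearMap.mkContinuous
    { toFun := fun θ => ∫ ω, θ ω • Φ ω ∂μ
      map_add' := fun θ η => ?_
      map_smul' := fun c θ => ?_ }
    (|B| * (μ univ ^ (1 / (1 : ℝ≥0∞).toReal - 1 / (2 : ℝ≥0∞).toReal)).toReal) fun θ => ?_,
    fun θ => rfl⟩
  · rw [← integral_add (hint θ) (hint η)]
    refine integral_congr_ae ?_
    filter_upwards [Lp.coeFn_add θ η] with ω h
    rw [h, Pi.add_apply, add_smul]
  · rw [RingHom.id_apply, ← integral_smul]
    refine integral_congr_ae ?_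
    filter_upwards [Lp.coeFn_smul c θ] with ω h
    rw [h, Pi.smul_apply, smul_eq_mul, mul_smul]
  · calc ‖∫ ω, θ ω • Φ ω ∂μ‖ ≤ ∫ ω, ‖θ ω‖ * |B| ∂μ := by
          refine norm_integral_le_of_norm_le
            (((Lp.memLp θ).integrable (by norm_num)).norm.mul_const _) (.of_forall fun ω => ?_)
          rw [norm_smul]
          exact mul_le_mul_of_nonneg_left ((hB ω).trans (le_abs_self B)) (norm_nonneg _)
      _ = |B| * ∫ ω, ‖θ ω‖ ∂μ := by rw [integral_mul_const, mul_comm]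
      _ ≤ |B| * (‖θ‖ * _) := mul_le_mul_of_nonneg_left (hΩ θ) (abs_nonneg B)
      _ = _ := by ring

/-- A vector dominated by the support function of the weighted means `∫ θ • Φ`, `0 ≤ θ ≤ 1`, is
such a weighted mean. -/
theorem exists_weight_integral_smul_eq [CompleteSpace H] (μ : Measure Ω) [IsFiniteMeasure μ]
    (hΦ : StronglyMeasurable Φ) (hB : ∀ ω, ‖Φ ω‖ ≤ B) (v : H)
    (hv : ∀ g, inner ℝ g v ≤ ∫ ω, max (inner ℝ g (Φ ω)) 0 ∂μ) :
    ∃ θ : Ω → ℝ, Measurable θ ∧ (∀ ω, θ ω ∈ Icc (0 : ℝ) 1) ∧ ∫ ω, θ ω • Φ ω ∂μ = v := by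
  obtain ⟨T, hT⟩ := exists_continuousLinearMap_integral_smul μ hΦ hB
  have : PosSMulMono ℝ (Lp ℝ 2 μ) := ⟨fun c hc θ η hθη => by
    rw [← Lp.coeFn_le] at hθη ⊢
    filter_upwards [hθη, Lp.coeFn_smul c θ, Lp.coeFn_smul c η] with ω h h1 h2
    rw [h1, h2]
    exact mul_le_mul_of_nonneg_left h hc⟩
  set C : Set (Lp ℝ 2 μ) := Icc 0 (Lp.const 2 μ (1 : ℝ)) with hC
  have hcl : IsClosed (T '' C) :=
    isClosed_image_of_closed_convex_bounded T isClosed_Icc (convex_Icc _ _)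
      (M := ‖Lp.const 2 μ (1 : ℝ)‖) fun θ hθ => norm_le_norm_of_abs_le_abs (by
        rw [abs_of_nonneg hθ.1, abs_of_nonneg (hθ.1.trans hθ.2)]; exact hθ.2)
  have hconv : Convex ℝ (T '' C) := (convex_Icc _ _).linear_image T.toLinearMap
  by_cases hmem : v ∈ T '' C
  · obtain ⟨θ, hθ, rfl⟩ := hmem
    -- Truncation turns the almost everywhere bounds on the `L²` class into bounds at every point.
    refine ⟨fun ω => max 0 (min (θ ω) 1),
      measurable_const.max ((Lp.stronglyMeasurable θ).measurable.min measurable_const),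
      fun ω => ⟨le_max_left _ _, max_le zero_le_one (min_le_right _ _)⟩, ?_⟩
    rw [hT]
    refine integral_congr_ae ?_
    filter_upwards [(Lp.coeFn_nonneg θ).2 hθ.1, (Lp.coeFn_le _ _).2 hθ.2,
      Lp.coeFn_const (p := 2) (μ := μ) (1 : ℝ)] with ω h0 h1 h2
    rw [h2] at h1
    simp only [Function.const_apply, Pi.zero_apply] at h0 h1
    simp only [min_eq_left h1, max_eq_right h0]
  · exfalso
    obtain ⟨f, u, hfu, huf⟩ := geometric_hahn_banach_closed_point hconv hcl hmem
    set g : H := (InnerProductSpace.toDual ℝ H).symm f with hg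
    have hgf : ∀ x, inner ℝ g x = f x := fun x => InnerProductSpace.toDual_symm_apply
    have hmeas : Measurable fun ω => (inner ℝ g (Φ ω) : ℝ) :=
      (stronglyMeasurable_const.inner hΦ).measurable
    -- For the separating direction `g`, the indicator of this set is the best weight: its mean
    -- pairs with `g` to the integral of the positive part, contradicting `hv`.
    set s : Set Ω := {ω | 0 ≤ (inner ℝ g (Φ ω) : ℝ)} with hs
    have hsm : MeasurableSet s := measurableSet_le measurable_const hmeas
    set θ : Lp ℝ 2 μ := indicatorConstLp 2 hsm (measure_ne_top μ s) (1 : ℝ) with hθ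
    have hθs : ⇑θ =ᵐ[μ] s.indicator fun _ => (1 : ℝ) := indicatorConstLp_coeFn
    have hθC : θ ∈ C := by
      refine ⟨(Lp.coeFn_nonneg θ).1 ?_, (Lp.coeFn_le _ _).1 ?_⟩
      · filter_upwards [hθs] with ω h
        rw [h]
        exact indicator_nonneg (fun _ _ => zero_le_one) ω
      · filter_upwards [hθs, Lp.coeFn_const (p := 2) (μ := μ) (1 : ℝ)] with ω h h1
        rw [h, h1]
        exact indicator_le_self' (fun _ _ => zero_le_one) ω
    have h1 := hfu _ ⟨θ, hθC, rfl⟩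
    have hΦint : Integrable (fun ω => θ ω • Φ ω) μ :=
      ((Lp.memLp θ).integrable (by norm_num)).smul_bdd B hΦ.aestronglyMeasurable (.of_forall hB)
    have h2 : f (T θ) = ∫ ω, max (inner ℝ g (Φ ω)) 0 ∂μ := by
      rw [hT, ← ContinuousLinearMap.integral_comp_comm f hΦint]
      refine integral_congr_ae ?_
      filter_upwards [hθs] with ω h
      rw [h, map_smul, ← hgf, smul_eq_mul]
      by_cases hω : ω ∈ s
      · rw [indicator_of_mem hω, one_mul, max_eq_left hω]
      · rw [indicator_of_notMem hω, zero_mul, max_eq_right (not_le.1 hω).le]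
    have h3 := hv g
    rw [hgf] at h3
    linarith

/-- The density version: a vector between the extreme values of the integrals `∫ h • Φ`,
`lo ≤ h ≤ hi`, in each direction is such an integral. -/
theorem exists_selection_integral_smul_eq [CompleteSpace H] (μ : Measure Ω)
    (hΦ : StronglyMeasurable Φ) (hB : ∀ ω, ‖Φ ω‖ ≤ B) {lo hi : Ω → ℝ} (hlo : Measurable lo)
    (hhi : Measurable hi) (hlohi : ∀ ω, lo ω ≤ hi ω) (hloi : Integrable lo μ)
    (hhii : Integrable hi μ) (v : H)
    (hv : ∀ g, inner ℝ g v ≤ ∫ ω, (lo ω * inner ℝ g (Φ ω) +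
      (hi ω - lo ω) * max (inner ℝ g (Φ ω)) 0) ∂μ) :
    ∃ h : Ω → ℝ, Measurable h ∧ (∀ ω, h ω ∈ Icc (lo ω) (hi ω)) ∧ ∫ ω, h ω • Φ ω ∂μ = v := by
  -- Writing `h = lo + θ * (hi - lo)` reduces the claim to weights `θ` in `[0, 1]` for the finite
  -- measure with density `hi - lo`.
  set w : Ω → ℝ≥0∞ := fun ω => ENNReal.ofReal (hi ω - lo ω) with hw
  have hwm : Measurable w := (hhi.sub hlo).ennreal_ofReal
  have hwtop : ∀ᵐ ω ∂μ, w ω < ∞ := .of_forall fun ω => ENNReal.ofReal_lt_top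
  have hwr : ∀ ω, (w ω).toReal = hi ω - lo ω := fun ω =>
    ENNReal.toReal_ofReal (sub_nonneg.2 (hlohi ω))
  have hfin : IsFiniteMeasure (μ.withDensity w) :=
    isFiniteMeasure_withDensity_ofReal (hhii.sub hloi).2
  have hloΦ : Integrable (fun ω => lo ω • Φ ω) μ :=
    hloi.smul_bdd B hΦ.aestronglyMeasurable (.of_forall hB)
  have hinner : ∀ g, StronglyMeasurable fun ω => (inner ℝ g (Φ ω) : ℝ) := fun g =>
    stronglyMeasurable_const.inner hΦ
  have hinner_le : ∀ g ω, ‖(inner ℝ g (Φ ω) : ℝ)‖ ≤ ‖g‖ * B := fun g ω =>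
    (norm_inner_le_norm _ _).trans (mul_le_mul_of_nonneg_left (hB ω) (norm_nonneg _))
  obtain ⟨θ, hθm, hθ, hθv⟩ := exists_weight_integral_smul_eq (μ.withDensity w) hΦ hB
    (v - ∫ ω, lo ω • Φ ω ∂μ) fun g => by
      rw [integral_withDensity_eq_integral_toReal_smul hwm hwtop, inner_sub_right,
        ← integral_inner hloΦ]
      have h1 : Integrable (fun ω => lo ω * (inner ℝ g (Φ ω) : ℝ)) μ :=
        hloi.mul_bdd (c := ‖g‖ * B) (hinner g).aestronglyMeasurable (.of_forall (hinner_le g))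
      have h2 : Integrable (fun ω => (hi ω - lo ω) * max (inner ℝ g (Φ ω) : ℝ) 0) μ := by
        refine (hhii.sub hloi).mul_bdd (c := ‖g‖ * B)
          ((hinner g).sup stronglyMeasurable_const).aestronglyMeasurable
          (.of_forall fun ω => ?_)
        refine le_trans ?_ (hinner_le g ω)
        rw [Real.norm_of_nonneg (le_max_right _ _)]
        exact max_le (Real.le_norm_self _) (norm_nonneg _)
      have h3 := hv g
      rw [integral_add h1 h2] at h3
      simp only [hwr, smul_eq_mul, inner_smul_right]
      linarith
  have hθΦ : Integrable (fun ω => (θ ω * (hi ω - lo ω)) • Φ ω) μ := by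
    refine Integrable.smul_bdd (φ := fun ω => θ ω * (hi ω - lo ω)) ?_ B
      hΦ.aestronglyMeasurable (.of_forall hB)
    refine (hhii.sub hloi).bdd_mul (c := 1) hθm.aestronglyMeasurable (.of_forall fun ω => ?_)
    rw [Real.norm_of_nonneg (hθ ω).1]
    exact (hθ ω).2
  refine ⟨fun ω => lo ω + θ ω * (hi ω - lo ω), hlo.add (hθm.mul (hhi.sub hlo)), fun ω => ?_, ?_⟩
  · have h0 := sub_nonneg.2 (hlohi ω)
    constructor
    · have := mul_nonneg (hθ ω).1 h0
      linarith
    · have := mul_le_mul_of_nonneg_right (hθ ω).2 h0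
      linarith
  · simp only [add_smul]
    rw [integral_add hloΦ hθΦ]
    rw [integral_withDensity_eq_integral_toReal_smul hwm hwtop] at hθv
    simp only [hwr, ← mul_smul, mul_comm _ (θ _)] at hθv
    rw [hθv]
    abel

end WeightedMean

/-! ### Convex families and their subgradient selections. -/

/-- A measurable family of nonnegative convex functions on the line with growth of order `p`,
up to the weight `A`. -/
structure IsConvexFamily {Ω : Type*} [MeasurableSpace Ω] (l : Ω → ℝ → ℝ) (A : Ω → ℝ)
    (c p : ℝ) : Prop where
  measurable : Measurable (Function.uncurry l)
  convex : ∀ ω, ConvexOn ℝ univ (l ω)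
  nonneg : ∀ ω t, 0 ≤ l ω t
  growth : ∀ ω t, l ω t ≤ c * (A ω + |t| ^ p + 1)
  weight_nonneg : ∀ ω, 0 ≤ A ω
  const_nonneg : 0 ≤ c
  one_le_exponent : 1 ≤ p

/-- A measurable function `h` that selects subgradients of `l ω` at `u ω`. -/
structure IsSubgradientSelection {Ω : Type*} [MeasurableSpace Ω] (l : Ω → ℝ → ℝ) (u h : Ω → ℝ) :
    Prop where
  measurable : Measurable h
  mul_sub_le : ∀ ω v, h ω * (v - u ω) ≤ l ω v - l ω (u ω)

section Family

variable {Ω : Type*} [MeasurableSpace Ω] {l : Ω → ℝ → ℝ} {A : Ω → ℝ} {c p : ℝ}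
  {μ : Measure Ω} [IsFiniteMeasure μ] {u h : Ω → ℝ} {M : ℝ} {p' : ℝ≥0∞}

lemma IsConvexFamily.isSubgradientSelection (hl : IsConvexFamily l A c p) (hh : Measurable h)
    (hmem : ∀ ω, h ω ∈ Icc (leftSlope (l ω) (u ω)) (rightSlope (l ω) (u ω))) :
    IsSubgradientSelection l u h :=
  ⟨hh, fun ω => mul_sub_le_of_mem_Icc_slopes (hl.convex ω) (hmem ω)⟩

lemma IsConvexFamily.isSubgradientSelection_leftSlope (hl : IsConvexFamily l A c p)
    (hu : Measurable u) : IsSubgradientSelection l u fun ω => leftSlope (l ω) (u ω) :=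
  hl.isSubgradientSelection (measurable_leftSlope hl.measurable hl.convex hu) fun ω =>
    left_mem_Icc.2 (leftSlope_le_rightSlope (hl.convex ω) _)

lemma IsConvexFamily.isSubgradientSelection_rightSlope (hl : IsConvexFamily l A c p)
    (hu : Measurable u) : IsSubgradientSelection l u fun ω => rightSlope (l ω) (u ω) :=
  hl.isSubgradientSelection (measurable_rightSlope hl.measurable hl.convex hu) fun ω =>
    right_mem_Icc.2 (leftSlope_le_rightSlope (hl.convex ω) _)

lemma IsConvexFamily.measurable_comp (hl : IsConvexFamily l A c p) (hu : Measurable u) :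
    Measurable fun ω => l ω (u ω) :=
  hl.measurable.comp (measurable_id.prodMk hu)

lemma IsConvexFamily.integrable_comp (hl : IsConvexFamily l A c p) (hA : Integrable A μ)
    (hu : Measurable u) (hM : ∀ ω, |u ω| ≤ M) : Integrable (fun ω => l ω (u ω)) μ := by
  refine Integrable.mono' (g := fun ω => c * (A ω + M ^ p + 1))
    (((hA.add (integrable_const _)).add (integrable_const _)).const_mul c)
    (hl.measurable_comp hu).aestronglyMeasurable (.of_forall fun ω => ?_)
  rw [Real.norm_of_nonneg (hl.nonneg _ _)]
  refine (hl.growth _ _).trans (mul_le_mul_of_nonneg_left ?_ hl.const_nonneg)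
  gcongr
  · linarith [hl.one_le_exponent]
  · exact hM ω

/-- The dominating function involves no measure, so one selection `h` serves every finite measure
integrating `A`. -/
lemma IsSubgradientSelection.memLp (hh : IsSubgradientSelection l u h)
    (hl : IsConvexFamily l A c p) (hA : Integrable A μ) (hM : ∀ ω, |u ω| ≤ M)
    (hp' : ENNReal.HolderConjugate (ENNReal.ofReal p) p') : MemLp h p' μ := by
  refine ((memLp_one_add_rpow hA hl.weight_nonneg hl.one_le_exponent hp').const_mul
    (c * ((M + 1) ^ p + 2))).mono' hh.measurable.aestronglyMeasurable (.of_forall fun ω => ?_)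
  exact subgradient_le_of_growth hl.one_le_exponent (hl.weight_nonneg ω) hl.const_nonneg
    (hl.nonneg _ _) (hl.growth ω) (hM ω) (hh.mul_sub_le ω)

lemma IsSubgradientSelection.integrable (hh : IsSubgradientSelection l u h)
    (hl : IsConvexFamily l A c p) (hA : Integrable A μ) (hM : ∀ ω, |u ω| ≤ M) :
    Integrable h μ := by
  have hp1 : 1 ≤ ENNReal.ofReal p := by simpa using hl.one_le_exponent
  exact (hh.memLp hl hA hM (ENNReal.HolderConjugate.conjExponent hp1)).integrable
    (by rw [ENNReal.conjExponent]; exact le_self_add)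

end Family

/-! ### The regularized risk of the linear model `⟪f, Φ ω⟫`. -/

section LinearModel

variable {Ω : Type*} [MeasurableSpace Ω] {l : Ω → ℝ → ℝ} {A : Ω → ℝ} {c p : ℝ}
  {μ : Measure Ω} [IsFiniteMeasure μ] {H : Type*} [NormedAddCommGroup H]
  [InnerProductSpace ℝ H] {Φ : Ω → H} {B : ℝ} {h : Ω → ℝ}

omit [MeasurableSpace Ω] in
lemma abs_inner_le_of_norm_le (hB : ∀ ω, ‖Φ ω‖ ≤ B) (f : H) (ω : Ω) :
    |inner ℝ f (Φ ω)| ≤ ‖f‖ * B :=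
  (abs_real_inner_le_norm _ _).trans (mul_le_mul_of_nonneg_left (hB ω) (norm_nonneg _))

lemma measurable_inner_right (hΦ : StronglyMeasurable Φ) (f : H) :
    Measurable fun ω => (inner ℝ f (Φ ω) : ℝ) :=
  (stronglyMeasurable_const.inner hΦ).measurable

lemma IsConvexFamily.integrable_inner (hl : IsConvexFamily l A c p) (hA : Integrable A μ)
    (hΦ : StronglyMeasurable Φ) (hB : ∀ ω, ‖Φ ω‖ ≤ B) (f : H) :
    Integrable (fun ω => l ω (inner ℝ f (Φ ω))) μ :=
  hl.integrable_comp hA (measurable_inner_right hΦ f) (abs_inner_le_of_norm_le hB f)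

/-- Integrated subgradients are subgradients of the integrated loss. -/
lemma IsSubgradientSelection.integral_add_inner_le [CompleteSpace H] {f : H}
    (hh : IsSubgradientSelection l (fun ω => inner ℝ f (Φ ω)) h) (hl : IsConvexFamily l A c p)
    (hA : Integrable A μ) (hΦ : StronglyMeasurable Φ) (hB : ∀ ω, ‖Φ ω‖ ≤ B) (g : H) :
    ∫ ω, l ω (inner ℝ f (Φ ω)) ∂μ + inner ℝ (∫ ω, h ω • Φ ω ∂μ) (g - f) ≤
      ∫ ω, l ω (inner ℝ g (Φ ω)) ∂μ := by
  have hhΦ : Integrable (fun ω => h ω • Φ ω) μ :=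
    (hh.integrable hl hA (abs_inner_le_of_norm_le hB f)).smul_bdd B hΦ.aestronglyMeasurable
      (.of_forall hB)
  rw [real_inner_comm, ← integral_inner hhΦ,
    ← integral_add (hl.integrable_inner hA hΦ hB f) (hhΦ.const_inner _)]
  refine integral_mono ((hl.integrable_inner hA hΦ hB f).add (hhΦ.const_inner _))
    (hl.integrable_inner hA hΦ hB g) fun ω => ?_
  have := hh.mul_sub_le ω (inner ℝ g (Φ ω))
  simp only [inner_smul_right, inner_sub_left]
  linarith

/-- First order condition: directional derivatives of the regularized integrated loss at a
minimizer are nonnegative. -/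
lemma IsConvexFamily.neg_inner_le_integral_directional (hl : IsConvexFamily l A c p)
    (hA : Integrable A μ) (hΦ : StronglyMeasurable Φ) (hB : ∀ ω, ‖Φ ω‖ ≤ B) {lam : ℝ} {f : H}
    (hf : ∀ g, ∫ ω, l ω (inner ℝ f (Φ ω)) ∂μ + lam * ‖f‖ ^ 2 ≤
      ∫ ω, l ω (inner ℝ g (Φ ω)) ∂μ + lam * ‖g‖ ^ 2) (g : H) :
    inner ℝ g (-((2 * lam) • f)) ≤
      ∫ ω, (leftSlope (l ω) (inner ℝ f (Φ ω)) * inner ℝ g (Φ ω) +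
        (rightSlope (l ω) (inner ℝ f (Φ ω)) - leftSlope (l ω) (inner ℝ f (Φ ω))) *
          max (inner ℝ g (Φ ω)) 0) ∂μ := by
  set ε : ℕ → ℝ := fun n => 1 / ((n : ℝ) + 1) with hε
  have hε0 : ∀ n, 0 < ε n := fun n => by simp only [hε]; positivity
  have hε1 : ∀ n, ε n ≤ 1 := fun n => by
    simp only [hε]
    rw [div_le_one (by positivity)]
    linarith [(Nat.cast_nonneg n : (0 : ℝ) ≤ n)]
  set D : ℕ → Ω → ℝ := fun n ω =>
    (l ω (inner ℝ (f + ε n • g) (Φ ω)) - l ω (inner ℝ f (Φ ω))) / ε n with hD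
  have hlin : ∀ n ω, (inner ℝ (f + ε n • g) (Φ ω) : ℝ) =
      inner ℝ f (Φ ω) + ε n * inner ℝ g (Φ ω) := fun n ω => by
    rw [inner_add_left, inner_smul_left]; simp
  have hrs := hl.isSubgradientSelection_rightSlope (measurable_inner_right hΦ f)
  have hrsi : Integrable (fun ω => rightSlope (l ω) (inner ℝ f (Φ ω))) μ :=
    hrs.integrable hl hA (abs_inner_le_of_norm_le hB f)
  have hbi : Integrable (fun ω => |rightSlope (l ω) (inner ℝ f (Φ ω)) * inner ℝ g (Φ ω)| +
      |l ω (inner ℝ (f + g) (Φ ω)) - l ω (inner ℝ f (Φ ω))|) μ :=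
    (hrsi.mul_bdd (c := ‖g‖ * B) (measurable_inner_right hΦ g).aestronglyMeasurable
      (.of_forall (abs_inner_le_of_norm_le hB g))).abs.add
      ((hl.integrable_inner hA hΦ hB (f + g)).sub (hl.integrable_inner hA hΦ hB f)).abs
  -- Domination uniform in `n`: the right slope is a subgradient and bounds the quotients below;
  -- convexity bounds them above by the increment for step `1`.
  have hbound : ∀ n ω, ‖D n ω‖ ≤
      |rightSlope (l ω) (inner ℝ f (Φ ω)) * inner ℝ g (Φ ω)| +
      |l ω (inner ℝ (f + g) (Φ ω)) - l ω (inner ℝ f (Φ ω))| := fun n ω => by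
    have hup : D n ω ≤ l ω (inner ℝ (f + g) (Φ ω)) - l ω (inner ℝ f (Φ ω)) := by
      simp only [hD, hlin, inner_add_left]
      exact slope_le_sub_of_le_one (hl.convex ω) (hε0 n) (hε1 n) _
    have hlow : rightSlope (l ω) (inner ℝ f (Φ ω)) * inner ℝ g (Φ ω) ≤ D n ω := by
      simp only [hD, hlin]
      rw [le_div_iff₀ (hε0 n)]
      have := hrs.mul_sub_le ω (inner ℝ f (Φ ω) + ε n * inner ℝ g (Φ ω))
      simp only [add_sub_cancel_left] at this
      linarith
    rw [Real.norm_eq_abs]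
    refine (abs_le_max_abs_abs hlow hup).trans (max_le ?_ ?_)
    · exact le_add_of_nonneg_right (abs_nonneg _)
    · exact le_add_of_nonneg_left (abs_nonneg _)
  have hlim := tendsto_integral_of_dominated_convergence (F := D) _
    (fun n => ((((hl.integrable_inner hA hΦ hB (f + ε n • g)).sub
      (hl.integrable_inner hA hΦ hB f)).div_const (ε n)).aestronglyMeasurable)) hbi
    (fun n => .of_forall (hbound n)) (.of_forall fun ω => by
      simp only [hD, hlin]
      exact tendsto_directional_slope (hl.convex ω) tendsto_one_div_nat_nhdsGT_zero _)
  -- Minimality against `f + ε n • g` gives this lower bound for the integrated quotients; the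
  -- regularizer's second-order term vanishes in the limit.
  have hlow : Tendsto (fun n => inner ℝ g (-((2 * lam) • f)) - lam * ‖g‖ ^ 2 * ε n) atTop
      (𝓝 (inner ℝ g (-((2 * lam) • f)) - lam * ‖g‖ ^ 2 * 0)) :=
    tendsto_const_nhds.sub (tendsto_one_div_add_atTop_nhds_zero_nat.const_mul _)
  rw [mul_zero, sub_zero] at hlow
  refine le_of_tendsto_of_tendsto' hlow hlim fun n => ?_
  have h1 := hf (f + ε n • g)
  rw [norm_add_sq_real, norm_smul, inner_smul_right, Real.norm_of_nonneg (hε0 n).le] at h1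
  simp only [hD]
  rw [integral_div, integral_sub (hl.integrable_inner hA hΦ hB _)
    (hl.integrable_inner hA hΦ hB f), le_div_iff₀ (hε0 n), inner_neg_right, inner_smul_right,
    real_inner_comm]
  linarith

/-- Representation of the minimizer of the regularized integrated loss. -/
theorem IsConvexFamily.exists_selection_of_minimizer [CompleteSpace H]
    (hl : IsConvexFamily l A c p) (hA : Integrable A μ) (hΦ : StronglyMeasurable Φ)
    (hB : ∀ ω, ‖Φ ω‖ ≤ B) {lam : ℝ} {f : H}
    (hf : ∀ g, ∫ ω, l ω (inner ℝ f (Φ ω)) ∂μ + lam * ‖f‖ ^ 2 ≤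
      ∫ ω, l ω (inner ℝ g (Φ ω)) ∂μ + lam * ‖g‖ ^ 2) :
    ∃ h, IsSubgradientSelection l (fun ω => inner ℝ f (Φ ω)) h ∧
      ∫ ω, h ω • Φ ω ∂μ = -((2 * lam) • f) := by
  have hls := hl.isSubgradientSelection_leftSlope (measurable_inner_right hΦ f)
  have hrs := hl.isSubgradientSelection_rightSlope (measurable_inner_right hΦ f)
  obtain ⟨h, hm, hmem, hint⟩ := exists_selection_integral_smul_eq μ hΦ hB hls.measurable
    hrs.measurable (fun ω => leftSlope_le_rightSlope (hl.convex ω) _)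
    (hls.integrable hl hA (abs_inner_le_of_norm_le hB f))
    (hrs.integrable hl hA (abs_inner_le_of_norm_le hB f)) _
    (hl.neg_inner_le_integral_directional hA hΦ hB hf)
  exact ⟨h, hl.isSubgradientSelection hm hmem, hint⟩

/-- The regularized integrated loss has a unique minimizer. -/
theorem IsConvexFamily.existsUnique_minimizer [CompleteSpace H]
    (hl : IsConvexFamily l A c p) (hA : Integrable A μ) (hΦ : StronglyMeasurable Φ)
    (hB : ∀ ω, ‖Φ ω‖ ≤ B) {lam : ℝ} (hlam : 0 < lam) :
    ∃! f : H, ∀ g, ∫ ω, l ω (inner ℝ f (Φ ω)) ∂μ + lam * ‖f‖ ^ 2 ≤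
      ∫ ω, l ω (inner ℝ g (Φ ω)) ∂μ + lam * ‖g‖ ^ 2 :=
  existsUnique_minimizer_of_subgradients
    (R := fun f : H => ∫ ω, l ω (inner ℝ f (Φ ω)) ∂μ)
    (fun _ => integral_nonneg fun _ => hl.nonneg _ _)
    (fun f => ⟨_, (hl.isSubgradientSelection_rightSlope
      (measurable_inner_right hΦ f)).integral_add_inner_le hl hA hΦ hB⟩) hlam

end LinearModel

/-! ### Stability of regularized minimizers. -/

section Stability

variable {H : Type*} [NormedAddCommGroup H] [InnerProductSpace ℝ H]

/-- The distance of a minimizer of a regularized function from a point `f` is controlled by the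
regularized subgradient at `f`. -/
lemma norm_sub_le_of_minimizer {R : H → ℝ} {f g w : H} {lam : ℝ} (hlam : 0 < lam)
    (hw : ∀ g, R f + inner ℝ w (g - f) ≤ R g)
    (hg : ∀ f, R g + lam * ‖g‖ ^ 2 ≤ R f + lam * ‖f‖ ^ 2) :
    ‖f - g‖ ≤ lam⁻¹ * ‖w + (2 * lam) • f‖ := by
  have h1 := add_inner_add_norm_sq_le hw lam g
  have h2 := hg f
  have h3 := neg_le_of_abs_le (abs_real_inner_le_norm (w + (2 * lam) • f) (g - f))
  rw [norm_sub_rev f g, inv_mul_eq_div, le_div_iff₀ hlam]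
  rcases (norm_nonneg (g - f)).eq_or_lt with h0 | h0
  · rw [← h0, zero_mul]; exact norm_nonneg _
  · refine le_of_mul_le_mul_right ?_ h0
    linarith [sq ‖g - f‖]

end Stability

/-! ### Norm and continuity of the canonical feature map. -/

section FeatureMap

variable {X : Type*} {H : Type*} [NormedAddCommGroup H] [InnerProductSpace ℝ H] [CompleteSpace H]
  [RKHS ℝ H X ℝ] {k : X → X → ℝ}

lemma inner_featureMap (f : H) (x : X) : inner ℝ f (featureMap H x) = f x := by
  simp [featureMap, RKHS.inner_kerFun]

lemma IsRKHSOf.inner_featureMap_featureMap (hH : IsRKHSOf H k) (x x' : X) :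
    inner ℝ (featureMap H x) (featureMap H x') = k x' x := by
  rw [inner_featureMap, hH]

lemma IsRKHSOf.norm_featureMap (hH : IsRKHSOf H k) (x : X) :
    ‖featureMap H x‖ = √(k x x) := by
  rw [norm_eq_sqrt_real_inner, hH.inner_featureMap_featureMap]

lemma IsRKHSOf.continuous_featureMap [TopologicalSpace X] (hH : IsRKHSOf H k)
    (hk : Continuous (Function.uncurry k)) : Continuous (featureMap H : X → H) := by
  refine continuous_iff_continuousAt.2 fun x => ?_
  rw [ContinuousAt, tendsto_iff_norm_sub_tendsto_zero]
  have e : ∀ y, ‖featureMap H y - featureMap H x‖ = √(k y y - 2 * k x y + k x x) := fun y => by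
    rw [← Real.sqrt_sq (norm_nonneg (featureMap H y - featureMap H x)), norm_sub_sq_real,
      ← real_inner_self_eq_norm_sq, ← real_inner_self_eq_norm_sq,
      hH.inner_featureMap_featureMap, hH.inner_featureMap_featureMap,
      hH.inner_featureMap_featureMap]
  have hc : Continuous fun y => √(k y y - 2 * k x y + k x x) :=
    (((hk.comp (continuous_id.prodMk continuous_id)).sub
      ((hk.comp (continuous_const.prodMk continuous_id)).const_mul 2)).add
        continuous_const).sqrt
  have h := hc.tendsto x
  simp only [e]
  convert h using 2
  rw [eq_comm, Real.sqrt_eq_zero']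
  linarith

end FeatureMap

/-! ### From `[0, ∞]`-valued risks to real integrals. -/

section Solution

variable {X : Type*} [MeasurableSpace X] {Y : Set ℝ} {L : Y → ℝ → ℝ} {a : Y → ℝ} {c p : ℝ}

lemma isConvexFamily_of_isLoss (hL : IsLoss L) (hLconv : IsConvexLoss L) (ha0 : ∀ y, 0 ≤ a y)
    (hc : 0 ≤ c) (hp : 1 ≤ p) (hgrowth : ∀ y t, L y t ≤ c * (a y + |t| ^ p + 1)) :
    IsConvexFamily (fun z : X × Y => L z.2) (fun z => a z.2) c p where
  measurable := hL.measurable.comp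
    ((measurable_snd.comp measurable_fst).prodMk measurable_snd)
  convex z := hLconv z.2
  nonneg z := hL.nonneg z.2
  growth z := hgrowth z.2
  weight_nonneg z := ha0 z.2
  const_nonneg := hc
  one_le_exponent := hp

lemma integrable_of_absMoment_lt_top (ha : Measurable a) (ha0 : ∀ y, 0 ≤ a y)
    {μ : Measure (X × Y)} (hμ : absMoment a μ < ∞) : Integrable (fun z : X × Y => a z.2) μ :=
  (lintegral_ofReal_ne_top_iff_integrable (ha.comp measurable_snd).aestronglyMeasurable
    (.of_forall fun z => ha0 z.2)).1 hμ.ne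

variable {H : Type*} [NormedAddCommGroup H] [InnerProductSpace ℝ H] [CompleteSpace H]
  [RKHS ℝ H X ℝ] {B : ℝ} {μ : Measure (X × Y)} [IsFiniteMeasure μ] {lam : ℝ}

lemma regRisk_eq_ofReal (hl : IsConvexFamily (fun z : X × Y => L z.2) (fun z => a z.2) c p)
    (hA : Integrable (fun z : X × Y => a z.2) μ)
    (hΦ : StronglyMeasurable fun z : X × Y => featureMap H z.1)
    (hB : ∀ x, ‖featureMap H x‖ ≤ B) (hlam : 0 ≤ lam) (f : H) :
    regRisk H L μ lam f = ENNReal.ofReal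
      (∫ z, L z.2 (inner ℝ f (featureMap H z.1)) ∂μ + lam * ‖f‖ ^ 2) := by
  rw [ENNReal.ofReal_add (integral_nonneg fun z => hl.nonneg z _) (by positivity),
    ofReal_integral_eq_lintegral_ofReal (hl.integrable_inner hA hΦ (fun z => hB z.1) f)
      (.of_forall fun z => hl.nonneg z _)]
  simp only [regRisk, risk, inner_featureMap]

theorem kbrSolution_isMinimizer
    (hl : IsConvexFamily (fun z : X × Y => L z.2) (fun z => a z.2) c p)
    (hA : Integrable (fun z : X × Y => a z.2) μ)
    (hΦ : StronglyMeasurable fun z : X × Y => featureMap H z.1)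
    (hB : ∀ x, ‖featureMap H x‖ ≤ B) (hlam : 0 < lam) (g : H) :
    ∫ z, L z.2 (inner ℝ (kbrSolution H L μ lam) (featureMap H z.1)) ∂μ +
        lam * ‖kbrSolution H L μ lam‖ ^ 2 ≤
      ∫ z, L z.2 (inner ℝ g (featureMap H z.1)) ∂μ + lam * ‖g‖ ^ 2 := by
  have hiff : ∀ f g : H, regRisk H L μ lam f ≤ regRisk H L μ lam g ↔
      ∫ z, L z.2 (inner ℝ f (featureMap H z.1)) ∂μ + lam * ‖f‖ ^ 2 ≤
        ∫ z, L z.2 (inner ℝ g (featureMap H z.1)) ∂μ + lam * ‖g‖ ^ 2 := fun f g => by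
    rw [regRisk_eq_ofReal hl hA hΦ hB hlam.le, regRisk_eq_ofReal hl hA hΦ hB hlam.le,
      ENNReal.ofReal_le_ofReal_iff]
    exact add_nonneg (integral_nonneg fun z => hl.nonneg z _) (by positivity)
  -- This excludes the default value `0` in the definition of `kbrSolution`.
  have hex : ∃! f : H, ∀ g : H, regRisk H L μ lam f ≤ regRisk H L μ lam g := by
    simp only [hiff]
    exact hl.existsUnique_minimizer hA hΦ (fun z => hB z.1) hlam
  rw [← hiff, kbrSolution, dif_pos hex]
  exact hex.choose_spec.1 g

end Solution

end KBR

/-! ### The representation and stability theorem. -/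

theorem theorem10
    {d : ℕ} (X : Set (EuclideanSpace ℝ (Fin d)))
    (Y : Set ℝ) (hYc : IsClosed Y) (hYne : Y.Nonempty)
    (p : ℝ) (hp : 1 ≤ p) (p' : ℝ≥0∞) (hp' : ENNReal.HolderConjugate (ENNReal.ofReal p) p')
    (a : Y → ℝ) (ha : Measurable a) (ha0 : ∀ y, 0 ≤ a y)
    (L : Y → ℝ → ℝ) (hL : KBR.IsLoss L) (hLconv : KBR.IsConvexLoss L)
    (hLtype : KBR.IsOfType L a p)
    (k : X → X → ℝ) (hkb : KBR.IsBoundedKernel k) (hkc : Continuous (Function.uncurry k))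
    (H : Type*) [NormedAddCommGroup H] [InnerProductSpace ℝ H] [CompleteSpace H]
    [RKHS ℝ H X ℝ] (hH : KBR.IsRKHSOf H k)
    (lam : ℝ) (hlam : 0 < lam)
    (P : Measure (X × Y)) [IsProbabilityMeasure P] (hP : KBR.absMoment a P < ∞) :
    ∃ h : X × Y → ℝ,
      Measurable h ∧ MemLp h p' P ∧
      (∀ (x : X) (y : Y),
        h (x, y) ∈ KBR.subdifferential (L y) (KBR.kbrSolution H L P lam x)) ∧
      Integrable (fun z => h z • KBR.featureMap H z.1) P ∧
      KBR.kbrSolution H L P lam =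
        -((2 * lam)⁻¹ • ∫ z, h z • KBR.featureMap H z.1 ∂P) ∧
      ∀ (Q : Measure (X × Y)) [IsProbabilityMeasure Q], KBR.absMoment a Q < ∞ →
        MemLp h 1 Q ∧
        Integrable (fun z => h z • KBR.featureMap H z.1) Q ∧
        ‖KBR.kbrSolution H L P lam - KBR.kbrSolution H L Q lam‖ ≤
          lam⁻¹ * ‖∫ z, h z • KBR.featureMap H z.1 ∂P - ∫ z, h z • KBR.featureMap H z.1 ∂Q‖ ∧
        (KBR.IsInvariantOfUpperOrder L p →
          KBR.absMoment (fun y : Y => |(y : ℝ)| ^ p) P < ∞ → MemLp h p' Q) := by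
  obtain ⟨B, hB⟩ := hkb
  obtain ⟨c, hc, hgrowth⟩ := hLtype
  have hΦB : ∀ x, ‖KBR.featureMap H x‖ ≤ B := fun x => by
    rw [hH.norm_featureMap]
    exact hB ⟨x, rfl⟩
  have hΦ : StronglyMeasurable fun z : X × Y => KBR.featureMap H z.1 :=
    (hH.continuous_featureMap hkc).stronglyMeasurable.comp_measurable measurable_fst
  have hl := KBR.isConvexFamily_of_isLoss (X := X) hL hLconv ha0 hc.le hp hgrowth
  have hA := KBR.integrable_of_absMoment_lt_top ha ha0 hP
  have hΦB' : ∀ z : X × Y, ‖KBR.featureMap H z.1‖ ≤ B := fun z => hΦB z.1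
  set f := KBR.kbrSolution H L P lam with hf
  obtain ⟨h, hh, hint⟩ := hl.exists_selection_of_minimizer hA hΦ hΦB'
    (KBR.kbrSolution_isMinimizer hl hA hΦ hΦB hlam)
  have hbound := KBR.abs_inner_le_of_norm_le hΦB' f
  have hinth : ∀ (Q : Measure (X × Y)) [IsProbabilityMeasure Q], KBR.absMoment a Q < ∞ →
      Integrable h Q := fun Q _ hQ =>
    hh.integrable hl (KBR.integrable_of_absMoment_lt_top ha ha0 hQ) hbound
  have hinthΦ : ∀ (Q : Measure (X × Y)) [IsProbabilityMeasure Q], KBR.absMoment a Q < ∞ →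
      Integrable (fun z => h z • KBR.featureMap H z.1) Q := fun Q _ hQ =>
    (hinth Q hQ).smul_bdd B hΦ.aestronglyMeasurable (.of_forall hΦB')
  refine ⟨h, hh.measurable, hh.memLp hl hA hbound hp', fun x y v => ?_, hinthΦ P hP, ?_,
    fun Q _ hQ => ?_⟩
  · have h1 := hh.mul_sub_le (x, y) v
    rw [← hf, KBR.inner_featureMap] at h1
    simp only [RCLike.inner_apply, conj_trivial]
    simpa [mul_comm] using h1
  · rw [hint, smul_neg, neg_neg, smul_smul, inv_mul_cancel₀ (by positivity), one_smul]
  · have hAQ := KBR.integrable_of_absMoment_lt_top ha ha0 hQ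
    refine ⟨memLp_one_iff_integrable.2 (hinth Q hQ), hinthΦ Q hQ, ?_,
      fun _ _ => hh.memLp hl hAQ hbound hp'⟩
    have h1 := KBR.norm_sub_le_of_minimizer
      (R := fun g : H => ∫ z, L z.2 (inner ℝ g (KBR.featureMap H z.1)) ∂Q) hlam
      (hh.integral_add_inner_le hl hAQ hΦ hΦB')
      (KBR.kbrSolution_isMinimizer hl hAQ hΦ hΦB hlam)
    -- Since `E_P hΦ = -2λf`, the regularized subgradient `E_Q hΦ + 2λf` in the stability bound
    -- equals `E_Q hΦ - E_P hΦ`.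
    rw [norm_sub_rev (∫ z, h z • KBR.featureMap H z.1 ∂P), hint, sub_neg_eq_add]
    exact h1
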